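/- Definitions. Let $[0,1]_G=\langle[0,1];\min,\max,\cdot,\to,0,1\rangle$ be the standard Gödel algebra, where $a\cdot b=\min\{a,b\}$, and $a\to b=1$ if $a\le b$ and $a\to b=b$ otherwise. A Gödel algebra is a member of the variety generated by $[0,1]_G$. A rational Gödel algebra is a Gödel algebra expanded with constants $\boldsymbol c_q$, for $q\in[0,1]\cap\mathbb Q$, that satisfies $\boldsymbol c_p\cdot\boldsymbol c_q\approx\boldsymbol c_{\min\{p,q\}}$, $\boldsymbol c_p\to\boldsymbol c_q\approx\boldsymbol c_{p\to q}$ (with $p\to q$ computed in $[0,1]_G$), $\boldsymbol c_0\approx 0$ and $\boldsymbol c_1\approx 1$. Rational Gödel logic $\mathbf{RG}$ is the logic over the variables $x_0,x_1,\dots$ in which $\Gamma\vdash\varphi$ iff there is a finite $\Delta\subseteq\Gamma$ such that, in every rational Gödel algebra, each assignment that gives the value $1$ to all members of $\Delta$ gives the value $1$ to $\varphi$. For a logic $\vdash$ and a set $\Sigma$ of formulas, $\vdash+\Sigma$ is the extension of $\vdash$ by all substitution instances of members of $\Sigma$ as axioms. Put $$\mathbf{RG}_r=\mathbf{RG}+\{\boldsymbol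 c_q: q\in[r,1]\cap\mathbb Q\}\quad(r\in(0,1]),\qquad \mathbf{RG}_p^{\omega}=\mathbf{RG}+\{\boldsymbol c_q: q\in(p,1]\cap\mathbb Q\}\quad(p\in[0,1)\cap\mathbb Q),$$ $$\mathbf{RG}_p^{n}=\mathbf{RG}_p^{\omega}+\bigvee_{0\le i<j\le n+2}\big((\boldsymbol c_p\lor x_i)\leftrightarrow(\boldsymbol c_p\lor x_j)\big)\quad(p\in[0,1)\cap\mathbb Q,\ n\in\omega),$$ where $\varphi\leftrightarrow\psi$ stands for $(\varphi\to\psi)\land(\psi\to\varphi)$. A logic is a finitary, substitution invariant consequence relation on formulas. A rule $\Gamma\rhd\varphi$ ($\Gamma$ finite) is derivable in $\vdash$ if $\Gamma\vdash\varphi$, and admissible in $\vdash$ if, for every substitution $\sigma$, whenever $\emptyset\vdash\sigma(\gamma)$ for all $\gamma\in\Gamma$, also $\emptyset\vdash\sigma(\varphi)$. A logic is structurally complete if all its admissible rules are derivable. The structural completion of $\vdash$ is its unique structurally complete extension with the same theorems (its derivable rules are exactly the rules admissible in $\vdash$). A set of rules is a base for the admissible rules of $\vdash$ if its addition to $\vdash$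 axiomatizes the structural completion of $\vdash$. Theorem. The following holds for every real $r\in(0,1]$, every $p\in[0,1)\cap\mathbb Q$ and every $\gamma\in\omega+1=\{0,1,2,\dots\}\cup\{\omega\}$ (with $z$ a variable): 1. A base for the admissible rules of $\mathbf{RG}_r$ is given by the rules $\boldsymbol c_q\lor z\rhd z$, for all $q\in[0,r)\cap\mathbb Q$. 2. A base for the admissible rules of $\mathbf{RG}_p^{\gamma}$ is given by the single rule $\boldsymbol c_p\lor z\rhd z$. -/

import Mathlib

/-- Formulas (terms) in the variables `x₀, x₁, …` over the language of BL-algebras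
`∧, ∨, ·, →, 0, 1`, expanded with a set `C` of additional constants. -/
inductive Fml (C : Type) : Type where
  | var : ℕ → Fml C
  | const : C → Fml C
  | zero : Fml C
  | one : Fml C
  | meet : Fml C → Fml C → Fml C
  | join : Fml C → Fml C → Fml C
  | mul : Fml C → Fml C → Fml C
  | imp : Fml C → Fml C → Fml C

/-- An interpretation of the BL-language on the set `A` (no laws are imposed here). -/
structure BLOps (A : Type) where
  meet : A → A → A
  join : A → A → A
  mul : A → A → A
  imp : A → A → A
  zero : A
  one : A

namespace Fml

variable {C : Type}

/-- The value of a formula in the algebra given by the operations `O` and the interpretation `κ`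
of the additional constants, under the assignment `v`. -/
def eval {A : Type} (O : BLOps A) (κ : C → A) (v : ℕ → A) : Fml C → A
  | var n => v n
  | const c => κ c
  | zero => O.zero
  | one => O.one
  | meet a b => O.meet (eval O κ v a) (eval O κ v b)
  | join a b => O.join (eval O κ v a) (eval O κ v b)
  | mul a b => O.mul (eval O κ v a) (eval O κ v b)
  | imp a b => O.imp (eval O κ v a) (eval O κ v b)

/-- The substitution (endomorphism of the formula algebra) determined by `σ`. -/
def subst (σ : ℕ → Fml C) : Fml C → Fml C
  | var n => σ n
  | const c => const c
  | zero => zero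
  | one => one
  | meet a b => meet (subst σ a) (subst σ b)
  | join a b => join (subst σ a) (subst σ b)
  | mul a b => mul (subst σ a) (subst σ b)
  | imp a b => imp (subst σ a) (subst σ b)

/-- The biconditional `a ↔ b`. -/
def iff (a b : Fml C) : Fml C := meet (imp a b) (imp b a)

/-- The disjunction of a finite list of formulas. -/
def bigJoin (l : List (Fml C)) : Fml C := l.foldr join zero

end Fml

/-! ### Propositional logics -/

section Logics

variable {C : Type}

/-- `L` is a (propositional) logic: a consequence relation on the set of formulas that is
substitution invariant and finitary. -/
structure IsLogic (L : Set (Fml C) → Fml C → Prop) : Prop where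
  refl : ∀ (Γ : Set (Fml C)) (φ : Fml C), φ ∈ Γ → L Γ φ
  cut : ∀ (Γ Δ : Set (Fml C)) (φ : Fml C), (∀ ψ ∈ Δ, L Γ ψ) → L Δ φ → L Γ φ
  subst : ∀ (σ : ℕ → Fml C) (Γ : Set (Fml C)) (φ : Fml C),
    L Γ φ → L (Fml.subst σ '' Γ) (Fml.subst σ φ)
  finitary : ∀ (Γ : Set (Fml C)) (φ : Fml C), L Γ φ → ∃ Δ : Finset (Fml C), ↑Δ ⊆ Γ ∧ L ↑Δ φ

/-- A rule `Γ ▷ φ`, where `Γ` is a finite set of formulas. -/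
abbrev PropRule (C : Type) : Type := Finset (Fml C) × Fml C

/-- The rule `ρ` is derivable in `L`. -/
def Derivable (L : Set (Fml C) → Fml C → Prop) (ρ : PropRule C) : Prop :=
  L ↑ρ.1 ρ.2

/-- The rule `ρ` is admissible in `L`. -/
def Admissible (L : Set (Fml C) → Fml C → Prop) (ρ : PropRule C) : Prop :=
  ∀ σ : ℕ → Fml C, (∀ γ ∈ ρ.1, L ∅ (Fml.subst σ γ)) → L ∅ (Fml.subst σ ρ.2)

/-- Structural completeness: every admissible rule is derivable. -/
def StructurallyComplete (L : Set (Fml C) → Fml C → Prop) : Prop :=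
  ∀ ρ : PropRule C, Admissible L ρ → Derivable L ρ

/-- `L'` is the structural completion of `L`, that is, the (unique) structurally complete
extension of `L` with the same theorems. -/
structure IsStructuralCompletion (L L' : Set (Fml C) → Fml C → Prop) : Prop where
  isLogic : IsLogic L'
  extension : ∀ (Γ : Set (Fml C)) (φ : Fml C), L Γ φ → L' Γ φ
  structurallyComplete : StructurallyComplete L'
  theorems : ∀ φ : Fml C, L' ∅ φ ↔ L ∅ φ

/-- The axiomatic extension `L + S`: all substitution instances of the formulas in `S` are
added to `L` as axioms. -/
def axExt (L : Set (Fml C) → Fml C → Prop) (S : Set (Fml C)) :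
    Set (Fml C) → Fml C → Prop :=
  fun Γ φ => L (Γ ∪ {χ | ∃ ψ ∈ S, ∃ σ : ℕ → Fml C, χ = Fml.subst σ ψ}) φ

/-- The extension of `L` axiomatized by the rules in `R`: `AddRules L R Γ φ` holds when `φ` can be
derived from `Γ` using the consequences valid in `L` and the substitution instances of the rules
in `R`. -/
inductive AddRules (L : Set (Fml C) → Fml C → Prop) (R : Set (PropRule C)) (Γ : Set (Fml C)) :
    Fml C → Prop where
  | hyp (φ : Fml C) (h : φ ∈ Γ) : AddRules L R Γ φ
  | base (Δ : Set (Fml C)) (φ : Fml C) (hΔ : ∀ δ ∈ Δ, AddRules L R Γ δ) (h : L Δ φ) :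
      AddRules L R Γ φ
  | rule (ρ : PropRule C) (hρ : ρ ∈ R) (σ : ℕ → Fml C)
      (h : ∀ γ ∈ ρ.1, AddRules L R Γ (Fml.subst σ γ)) : AddRules L R Γ (Fml.subst σ ρ.2)

/-- The set of rules `R` is a base for the admissible rules of `L`: the addition of `R` to `L`
axiomatizes the structural completion of `L`. -/
def IsBaseOfAdmissibleRules (L : Set (Fml C) → Fml C → Prop) (R : Set (PropRule C)) : Prop :=
  IsStructuralCompletion L (AddRules L R)

end Logics

/-! ### Rational Gödel algebras and rational Gödel logic -/

/-- The set `[0, 1] ∩ ℚ` that indexes the constants `c_q`. -/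
abbrev RatUnit : Type := Set.Icc (0 : ℚ) 1

/-- Formulas of rational Gödel logic. -/
abbrev RFml : Type := Fml RatUnit

/-- The standard Gödel algebra on `[0, 1]`: the product is the minimum, and the implication is its
residuum. -/
noncomputable def standardGodel : BLOps (Set.Icc (0 : ℝ) 1) where
  meet a b := min a b
  join a b := max a b
  mul a b := min a b
  imp a b := if a ≤ b then 1 else b
  zero := 0
  one := 1

/-- Gödel algebras are the members of the variety generated by the standard Gödel algebra: the
algebras in the BL-language (without additional constants) that satisfy every equation `s ≈ t`
valid in the standard Gödel algebra. -/
def IsGodelAlgebra {A : Type} (O : BLOps A) : Prop :=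
  ∀ s t : Fml Empty,
    (∀ v : ℕ → Set.Icc (0 : ℝ) 1,
      s.eval standardGodel Empty.elim v = t.eval standardGodel Empty.elim v) →
    ∀ v : ℕ → A, s.eval O Empty.elim v = t.eval O Empty.elim v

/-- Rational Gödel algebras: the BL-reduct is a Gödel algebra and the bookkeeping axioms hold for
the interpretation `κ` of the constants. -/
structure IsRationalGodelAlgebra {A : Type} (O : BLOps A) (κ : RatUnit → A) : Prop where
  godel : IsGodelAlgebra O
  const_mul : ∀ p q : RatUnit, O.mul (κ p) (κ q) = κ (min p q)
  const_imp : ∀ p q : RatUnit, O.imp (κ p) (κ q) = κ (if p ≤ q then 1 else q)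
  const_zero : κ 0 = O.zero
  const_one : κ 1 = O.one

/-- Rational Gödel logic. Since the set of formulas is countable and subalgebras of rational Gödel
algebras are again such, algebras in `Type` are enough to compute the consequence relation. -/
def RG (Γ : Set RFml) (φ : RFml) : Prop :=
  ∃ Δ : Finset RFml, ↑Δ ⊆ Γ ∧
    ∀ (A : Type) (O : BLOps A) (κ : RatUnit → A), IsRationalGodelAlgebra O κ →
      ∀ v : ℕ → A, (∀ δ ∈ Δ, δ.eval O κ v = O.one) → φ.eval O κ v = O.one

/-- The logic `RG_r = RG + {c_q : q ∈ [r, 1] ∩ ℚ}`. -/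
def RGr (r : ℝ) : Set RFml → RFml → Prop :=
  axExt RG {φ | ∃ q : RatUnit, r ≤ ((q : ℚ) : ℝ) ∧ φ = Fml.const q}

/-- The formula `⋁_{0 ≤ i < j ≤ n + 2} ((c_p ∨ x_i) ↔ (c_p ∨ x_j))`. -/
def chainBound (p : RatUnit) (n : ℕ) : RFml :=
  Fml.bigJoin ((List.range (n + 3)).flatMap fun j => (List.range j).map fun i =>
    Fml.iff (Fml.join (Fml.const p) (Fml.var i)) (Fml.join (Fml.const p) (Fml.var j)))

/-- The logics `RG_p^γ` for `γ ∈ ω + 1`: `RG_p^ω = RG + {c_q : q ∈ (p, 1] ∩ ℚ}`, and `RG_p^n` is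
the axiomatic extension of `RG_p^ω` by the formula `chainBound p n`. -/
def RGpγ (p : RatUnit) (γ : ℕ∞) : Set RFml → RFml → Prop :=
  axExt RG ({φ | ∃ q : RatUnit, p < q ∧ φ = Fml.const q} ∪
    {φ | ∃ n : ℕ, γ = (n : ℕ∞) ∧ φ = chainBound p n})

/-- The rule `c_q ∨ z ▷ z`. -/
def constRule (q : RatUnit) : PropRule RatUnit :=
  ({Fml.join (Fml.const q) (Fml.var 0)}, Fml.var 0)

/-! ### Substitution, and evaluation in the standard Gödel algebra -/

/-! Let `D` be the set of constants that are not axiomatically equal to 1 (`q < r`, respectively `q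
≤ p`) and `Q ⊆ D` the cofinal set indexing the rules. By `RG_of_standard`, a consequence of `RG` may
be checked in `[0,1]`, with constants interpreted so that 0 and 1 are correct and, on a prescribed
finite set, `s < t` forces `κ s < κ t` or `κ s = κ t = 1`. The reference model is `[0,1]` with the
constants in `D` naming themselves and all others naming 1 (`constIn`), under assignments with few
values above `p` if `γ` is finite. The rules are sound there: joins are maxima, and no constant in
`Q` has value 1.

The rules add no theorems, because every refutation of a formula can be moved into the reference
model (`exists_rational_model`).

For structural completeness, suppose `Γ ▷ φ` is not derivable with the rules. Then `Γ` does not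
yield `c_u ∨ φ` for any `u ∈ Q`. Take `u` above all constants from `D` in the rule. A refutation
keeps `c_u` below 1, so none of these constants collapses, and the move into the reference model
also keeps `Γ` true. All values are now rational. Those up to `u` are named by constants; the
finitely many between `u` and 1 are imitated by the formulas `chainFml`, whose values increase
strictly until they reach 1, whatever the assignment. The resulting substitution turns `Γ` into
theorems (`chainRel_chainFml`), but not `φ`, since a suitable assignment gives back the original
values (`eval_chainFml_of_strictMono`). So the rule is not admissible. -/

/-- The real unit interval. -/
abbrev UnitI : Type := Set.Icc (0 : ℝ) 1

namespace Fml

variable {C : Type}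

theorem eval_subst {A : Type} (O : BLOps A) (κ : C → A) (v : ℕ → A) (σ : ℕ → Fml C) (φ : Fml C) :
    (φ.subst σ).eval O κ v = φ.eval O κ (fun n => (σ n).eval O κ v) := by
  induction φ with
  | var n => rfl
  | const c => rfl
  | zero => rfl
  | one => rfl
  | meet a b iha ihb => simp only [subst, eval, iha, ihb]
  | join a b iha ihb => simp only [subst, eval, iha, ihb]
  | mul a b iha ihb => simp only [subst, eval, iha, ihb]
  | imp a b iha ihb => simp only [subst, eval, iha, ihb]

theorem subst_subst (σ τ : ℕ → Fml C) (φ : Fml C) :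
    (φ.subst σ).subst τ = φ.subst (fun n => (σ n).subst τ) := by
  induction φ with
  | var n => rfl
  | const c => rfl
  | zero => rfl
  | one => rfl
  | meet a b iha ihb => simp only [subst, iha, ihb]
  | join a b iha ihb => simp only [subst, iha, ihb]
  | mul a b iha ihb => simp only [subst, iha, ihb]
  | imp a b iha ihb => simp only [subst, iha, ihb]

open Classical in
/-- The additional constants occurring in a formula. -/
noncomputable def consts : Fml C → Finset C
  | var _ => ∅
  | const c => {c}
  | zero => ∅
  | one => ∅
  | meet a b => consts a ∪ consts b
  | join a b => consts a ∪ consts b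
  | mul a b => consts a ∪ consts b
  | imp a b => consts a ∪ consts b

/-- The variables occurring in a formula. -/
def vars : Fml C → Finset ℕ
  | var n => {n}
  | const _ => ∅
  | zero => ∅
  | one => ∅
  | meet a b => vars a ∪ vars b
  | join a b => vars a ∪ vars b
  | mul a b => vars a ∪ vars b
  | imp a b => vars a ∪ vars b

end Fml

theorem standardGodel_imp_eq_one {a b : UnitI} : standardGodel.imp a b = 1 ↔ a ≤ b := by
  change (if a ≤ b then (1 : UnitI) else b) = 1 ↔ a ≤ b
  split_ifs with h
  · simp [h]
  · constructor
    · rintro rfl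
      exact unitInterval.le_one'
    · intro h'
      exact absurd h' h

theorem standardGodel_imp_of_le {a b : UnitI} (h : a ≤ b) : standardGodel.imp a b = 1 :=
  standardGodel_imp_eq_one.2 h

theorem standardGodel_imp_of_lt {a b : UnitI} (h : b < a) : standardGodel.imp a b = b :=
  if_neg (not_le.2 h)

/-! ### Relations between Gödel chains that are preserved by all formulas -/

/-- `Prec a b` says that `a < b` or that both elements are `1`: this is what homomorphisms of
Gödel chains preserve of the strict order. -/
def Prec (a b : UnitI) : Prop := a < b ∨ (a = 1 ∧ b = 1)

theorem Prec.le {a b : UnitI} (h : Prec a b) : a ≤ b := by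
  rcases h with h | ⟨rfl, rfl⟩
  · exact h.le
  · exact le_rfl

theorem Prec.trans {a b c : UnitI} (h : Prec a b) (h' : Prec b c) : Prec a c := by
  rcases h with h | ⟨rfl, rfl⟩
  · exact Or.inl (h.trans_le h'.le)
  · exact h'

theorem prec_one (a : UnitI) : Prec a 1 := by
  rcases eq_or_lt_of_le (unitInterval.le_one' (t := a)) with h | h
  · exact Or.inr ⟨h, rfl⟩
  · exact Or.inl h

/-- A relation between elements of the standard Gödel algebra that is compatible with all
operations. -/
structure ChainRel (r : UnitI → UnitI → Prop) : Prop where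
  zero : r 0 0
  one : r 1 1
  prec : ∀ a a' b b', r a a' → r b b' → a < b → Prec a' b'
  unique : ∀ a a' b', a ≠ 1 → r a a' → r a b' → a' = b'

namespace ChainRel

variable {r : UnitI → UnitI → Prop}

theorem min (hr : ChainRel r) {a a' b b' : UnitI} (ha : r a a') (hb : r b b') :
    r (min a b) (min a' b') := by
  rcases lt_trichotomy a b with h | rfl | h
  · rw [min_eq_left h.le, min_eq_left (hr.prec _ _ _ _ ha hb h).le]
    exact ha
  · rw [min_self]
    rcases min_choice a' b' with h | h <;> rw [h] <;> assumption
  · rw [min_eq_right h.le, min_eq_right (hr.prec _ _ _ _ hb ha h).le]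
    exact hb

theorem max (hr : ChainRel r) {a a' b b' : UnitI} (ha : r a a') (hb : r b b') :
    r (max a b) (max a' b') := by
  rcases lt_trichotomy a b with h | rfl | h
  · rw [max_eq_right h.le, max_eq_right (hr.prec _ _ _ _ ha hb h).le]
    exact hb
  · rw [max_self]
    rcases max_choice a' b' with h | h <;> rw [h] <;> assumption
  · rw [max_eq_left h.le, max_eq_left (hr.prec _ _ _ _ hb ha h).le]
    exact ha

/-- The case of equal arguments dictates the definition of `ChainRel`. Away from 1,
single-valuedness gives the implication of the images the value 1. At 1 it takes the value 1 or
`b'`, and both are related to 1, so several images of 1 do no harm. -/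
theorem imp (hr : ChainRel r) {a a' b b' : UnitI} (ha : r a a') (hb : r b b') :
    r (standardGodel.imp a b) (standardGodel.imp a' b') := by
  rcases lt_trichotomy a b with h | rfl | h
  · rw [standardGodel_imp_of_le h.le, standardGodel_imp_of_le (hr.prec _ _ _ _ ha hb h).le]
    exact hr.one
  · rw [standardGodel_imp_of_le le_rfl]
    by_cases h1 : a = 1
    · subst h1
      rcases le_or_gt a' b' with h | h
      · rw [standardGodel_imp_of_le h]
        exact hr.one
      · rw [standardGodel_imp_of_lt h]
        exact hb
    · rw [hr.unique a a' b' h1 ha hb, standardGodel_imp_of_le le_rfl]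
      exact hr.one
  · rw [standardGodel_imp_of_lt h]
    rcases hr.prec _ _ _ _ hb ha h with h' | ⟨h1, h2⟩
    · rw [standardGodel_imp_of_lt h']
      exact hb
    · rw [h1, h2, standardGodel_imp_of_le le_rfl]
      rwa [h1] at hb

theorem eval {C : Type} (hr : ChainRel r) {κ κ' : C → UnitI} {v v' : ℕ → UnitI} (φ : Fml C)
    (hκ : ∀ c ∈ φ.consts, r (κ c) (κ' c)) (hv : ∀ n ∈ φ.vars, r (v n) (v' n)) :
    r (φ.eval standardGodel κ v) (φ.eval standardGodel κ' v') := by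
  induction φ with
  | var n => exact hv n (by simp [Fml.vars])
  | const c => exact hκ c (by simp [Fml.consts])
  | zero => exact hr.zero
  | one => exact hr.one
  | meet a b iha ihb =>
    simp only [Fml.consts, Fml.vars, Finset.mem_union] at hκ hv
    exact hr.min (iha (fun c h => hκ c (Or.inl h)) fun c h => hv c (Or.inl h))
      (ihb (fun c h => hκ c (Or.inr h)) fun c h => hv c (Or.inr h))
  | join a b iha ihb =>
    simp only [Fml.consts, Fml.vars, Finset.mem_union] at hκ hv
    exact hr.max (iha (fun c h => hκ c (Or.inl h)) fun c h => hv c (Or.inl h))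
      (ihb (fun c h => hκ c (Or.inr h)) fun c h => hv c (Or.inr h))
  | mul a b iha ihb =>
    simp only [Fml.consts, Fml.vars, Finset.mem_union] at hκ hv
    exact hr.min (iha (fun c h => hκ c (Or.inl h)) fun c h => hv c (Or.inl h))
      (ihb (fun c h => hκ c (Or.inr h)) fun c h => hv c (Or.inr h))
  | imp a b iha ihb =>
    simp only [Fml.consts, Fml.vars, Finset.mem_union] at hκ hv
    exact hr.imp (iha (fun c h => hκ c (Or.inl h)) fun c h => hv c (Or.inl h))
      (ihb (fun c h => hκ c (Or.inr h)) fun c h => hv c (Or.inr h))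

end ChainRel

/-- The endomorphism of the standard Gödel algebra that collapses `[w, 1]` to `1`. -/
noncomputable def collapse (w a : UnitI) : UnitI := if w ≤ a then 1 else a

theorem chainRel_collapse {w : UnitI} (hw : 0 < w) : ChainRel fun a a' => a' = collapse w a where
  zero := by simp [collapse, hw.ne']
  one := by simp [collapse]
  prec := by
    rintro a _ b _ rfl rfl h
    unfold collapse
    split_ifs with h1 h2 h2
    · exact prec_one _
    · exact absurd (h1.trans h.le) h2
    · exact prec_one _
    · exact Or.inl h
  unique := by
    rintro a _ _ - rfl rfl
    rfl

theorem eval_collapse {C : Type} {w : UnitI} (hw : 0 < w) (κ : C → UnitI) (v : ℕ → UnitI)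
    (φ : Fml C) : φ.eval standardGodel (fun c => collapse w (κ c)) (fun n => collapse w (v n)) =
      collapse w (φ.eval standardGodel κ v) :=
  (chainRel_collapse hw).eval φ (fun _ _ => rfl) fun _ _ => rfl

/-! ### Consequence in rational Gödel algebras, reduced to the unit interval -/

/-- Rational constants coded as additional variables. -/
def Fml.code : RFml → Fml Empty
  | .var n => .var (2 * n)
  | .const c => .var (2 * Encodable.encode c + 1)
  | .zero => .zero
  | .one => .one
  | .meet a b => .meet a.code b.code
  | .join a b => .join a.code b.code
  | .mul a b => .mul a.code b.code
  | .imp a b => .imp a.code b.code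

theorem eval_code {A : Type} (O : BLOps A) (v : ℕ → A) (φ : RFml) :
    φ.code.eval O Empty.elim v =
      φ.eval O (fun c => v (2 * Encodable.encode c + 1)) (fun n => v (2 * n)) := by
  induction φ with
  | var n => rfl
  | const c => rfl
  | zero => rfl
  | one => rfl
  | meet a b iha ihb => simp only [Fml.code, Fml.eval, iha, ihb]
  | join a b iha ihb => simp only [Fml.code, Fml.eval, iha, ihb]
  | mul a b iha ihb => simp only [Fml.code, Fml.eval, iha, ihb]
  | imp a b iha ihb => simp only [Fml.code, Fml.eval, iha, ihb]

/-- Every interpretation of variables and constants is given by an assignment of codes. -/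
theorem exists_code_assignment {A : Type} (κ : RatUnit → A) (v : ℕ → A) :
    ∃ w : ℕ → A, (fun c : RatUnit => w (2 * Encodable.encode c + 1)) = κ ∧
      (fun n => w (2 * n)) = v := by
  -- Even codes carry the variables and odd codes the constants; the default `v 0` is only met at
  -- odd codes that decode to no constant.
  refine ⟨fun n => if n % 2 = 0 then v (n / 2) else
    ((Encodable.decode (α := RatUnit) (n / 2)).map κ).getD (v 0), ?_, ?_⟩
  · funext c
    have h1 : (2 * Encodable.encode c + 1) % 2 = 1 := by omega
    have h2 : (2 * Encodable.encode c + 1) / 2 = Encodable.encode c := by omega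
    simp [h1, h2]
  · funext n
    simp

/-- Gödel algebras are defined by constant-free equations. Once constants are coded as variables,
these cover every interpretation `κ`. -/
theorem IsGodelAlgebra.eval_eq {A : Type} {O : BLOps A} (hO : IsGodelAlgebra O) (φ ψ : RFml)
    (h : ∀ κ v, φ.eval standardGodel κ v = ψ.eval standardGodel κ v) (κ : RatUnit → A)
    (v : ℕ → A) : φ.eval O κ v = ψ.eval O κ v := by
  obtain ⟨w, rfl, rfl⟩ := exists_code_assignment κ v
  rw [← eval_code, ← eval_code]
  refine hO _ _ (fun w => ?_) w
  rw [eval_code, eval_code, h]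

theorem IsGodelAlgebra.one_imp {A : Type} {O : BLOps A} (hO : IsGodelAlgebra O) (a : A) :
    O.imp O.one a = a := by
  refine hO (.imp .one (.var 0)) (.var 0) (fun v => ?_) (fun _ => a)
  change standardGodel.imp 1 (v 0) = v 0
  rcases eq_or_lt_of_le (unitInterval.le_one' (t := v 0)) with h | h
  · rw [h, standardGodel_imp_of_le le_rfl]
  · rw [standardGodel_imp_of_lt h]

/-- A semantic deduction theorem reduces consequences to equations, one premise at a time. If `δ →
φ` failed at some point, then `φ` would lie below `δ`; collapsing everything from the value of `δ`
upwards to 1 makes `δ` true and leaves `φ` false. -/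
theorem IsGodelAlgebra.eval_eq_one {A : Type} {O : BLOps A} (hO : IsGodelAlgebra O)
    (Δ : List RFml) (φ : RFml)
    (h : ∀ κ v, (∀ δ ∈ Δ, δ.eval standardGodel κ v = 1) → φ.eval standardGodel κ v = 1)
    (κ : RatUnit → A) (v : ℕ → A) (hΔ : ∀ δ ∈ Δ, δ.eval O κ v = O.one) :
    φ.eval O κ v = O.one := by
  induction Δ generalizing φ with
  | nil => exact hO.eval_eq φ .one (fun κ v => h κ v (by simp)) κ v
  | cons δ Δ ih =>
    have key : (Fml.imp δ φ).eval O κ v = O.one := by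
      refine ih _ (fun κ v hv => ?_) fun δ' h' => hΔ δ' (List.mem_cons_of_mem _ h')
      refine standardGodel_imp_of_le (not_lt.1 fun hlt => ?_)
      have hw : 0 < δ.eval standardGodel κ v := lt_of_le_of_lt unitInterval.nonneg' hlt
      have := h _ _ (fun δ' hδ' => (eval_collapse hw κ v δ').trans ?_)
      · rw [eval_collapse hw, collapse, if_neg (not_le.2 hlt)] at this
        rw [this] at hlt
        exact absurd hlt (not_lt.2 unitInterval.le_one')
      · rcases List.mem_cons.1 hδ' with rfl | hmem
        · simp [collapse]
        · rw [hv δ' hmem]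
          simp [collapse]
    have h1 := hΔ δ List.mem_cons_self
    rwa [Fml.eval, h1, hO.one_imp] at key

/-- The interpretation `κ` of the constants is as it has to be in a rational Gödel chain, as far
as the constants in `S` are concerned. -/
structure RespectsOn (S : Finset RatUnit) (κ : RatUnit → UnitI) : Prop where
  zero : κ 0 = 0
  one : κ 1 = 1
  prec : ∀ s ∈ S, ∀ t ∈ S, s < t → Prec (κ s) (κ t)

/-- The bookkeeping laws for the constants in `S` become finitely many further premises. For `s <
t`, the formulas `c_s → c_t` and `(c_t → c_s) → c_s` together force `Prec (κ s) (κ t)` in `[0,1]`.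
-/
theorem IsRationalGodelAlgebra.eval_eq_one {A : Type} {O : BLOps A} {κ : RatUnit → A}
    (hO : IsRationalGodelAlgebra O κ) (S : Finset RatUnit) (Δ : Finset RFml) (φ : RFml)
    (h : ∀ κ v, RespectsOn S κ → (∀ δ ∈ Δ, δ.eval standardGodel κ v = 1) →
      φ.eval standardGodel κ v = 1)
    (v : ℕ → A) (hΔ : ∀ δ ∈ Δ, δ.eval O κ v = O.one) : φ.eval O κ v = O.one := by
  refine hO.godel.eval_eq_one (Δ.toList ++ ([.imp (.const 0) .zero, .const 1] ++
    (S ×ˢ S).toList.flatMap fun st => if st.1 < st.2 then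
      [.imp (.const st.1) (.const st.2), .imp (.imp (.const st.2) (.const st.1)) (.const st.1)]
      else [])) φ (fun κ v hv => ?_) κ v fun δ hδ => ?_
  · have h0 := hv (.imp (.const 0) .zero) (by simp)
    have h1 := hv (.const 1) (by simp)
    refine h κ v ⟨?_, h1, fun s hs t ht hst => ?_⟩ fun δ hδ => hv δ (by simp [hδ])
    · exact le_antisymm (standardGodel_imp_eq_one.1 h0) unitInterval.nonneg'
    · have hmem : ∀ ψ ∈ [Fml.imp (.const s) (.const t),
          .imp (.imp (.const t) (.const s)) (.const s)], ψ.eval standardGodel κ v = 1 := by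
        intro ψ hψ
        refine hv ψ ?_
        simp only [List.mem_append, List.mem_flatMap]
        exact Or.inr (Or.inr ⟨(s, t), by simp [hs, ht], by rwa [if_pos hst]⟩)
      have h2 : κ s ≤ κ t := standardGodel_imp_eq_one.1 (hmem _ List.mem_cons_self)
      have h3 : standardGodel.imp (κ t) (κ s) ≤ κ s :=
        standardGodel_imp_eq_one.1 (hmem _ (List.mem_cons_of_mem _ List.mem_cons_self))
      rcases eq_or_lt_of_le h2 with h4 | h4
      · rw [← h4, standardGodel_imp_of_le le_rfl] at h3
        have h5 : κ s = 1 := le_antisymm unitInterval.le_one' h3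
        exact Or.inr ⟨h5, h4 ▸ h5⟩
      · exact Or.inl h4
  · have hself : ∀ s, O.imp (κ s) (κ s) = O.one := fun s => by
      rw [hO.const_imp, if_pos le_rfl, hO.const_one]
    simp only [List.mem_append, List.mem_flatMap, Finset.mem_toList] at hδ
    rcases hδ with hδ | hδ | ⟨⟨s, t⟩, -, hδ⟩
    · exact hΔ δ hδ
    · rcases List.mem_cons.1 hδ with rfl | hδ
      · change O.imp (κ 0) O.zero = O.one
        rw [← hO.const_zero, hself]
      · rw [List.mem_singleton.1 hδ]
        exact hO.const_one
    · split_ifs at hδ with hst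
      · rcases List.mem_cons.1 hδ with rfl | hδ
        · change O.imp (κ s) (κ t) = O.one
          rw [hO.const_imp, if_pos (le_of_lt hst), hO.const_one]
        · rw [List.mem_singleton.1 hδ]
          change O.imp (O.imp (κ t) (κ s)) (κ s) = O.one
          rw [hO.const_imp t s, if_neg (not_le.2 hst), hself]
      · simp at hδ

theorem RG_of_standard (S : Finset RatUnit) (Δ : Finset RFml) (φ : RFml)
    (h : ∀ κ v, RespectsOn S κ → (∀ δ ∈ Δ, δ.eval standardGodel κ v = 1) →
      φ.eval standardGodel κ v = 1) {Γ : Set RFml} (hΔ : ↑Δ ⊆ Γ) : RG Γ φ :=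
  ⟨Δ, hΔ, fun _ _ _ hO v hv => hO.eval_eq_one S Δ φ h v hv⟩

/-! ### The consequence relations are logics -/

theorem RG_isLogic : IsLogic RG where
  refl Γ φ h := ⟨{φ}, by simpa using h, fun _ _ _ _ _ hv => hv φ (by simp)⟩
  cut Γ Δ φ hΓ := by
    classical
    rintro ⟨Δ₀, hΔ₀, h⟩
    choose! F hF hF' using hΓ
    refine ⟨Δ₀.biUnion F, ?_, fun A O κ hO v hv => h A O κ hO v fun δ hδ =>
      hF' δ (hΔ₀ hδ) A O κ hO v fun χ hχ => hv χ (Finset.mem_biUnion.2 ⟨δ, hδ, hχ⟩)⟩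
    intro χ hχ
    obtain ⟨δ, hδ, hχ⟩ := Finset.mem_biUnion.1 (Finset.mem_coe.1 hχ)
    exact hF δ (hΔ₀ hδ) hχ
  subst σ Γ φ := by
    classical
    rintro ⟨Δ, hΔ, h⟩
    refine ⟨Δ.image (Fml.subst σ), ?_, fun A O κ hO v hv => ?_⟩
    · rw [Finset.coe_image]
      exact Set.image_mono hΔ
    · rw [Fml.eval_subst]
      refine h A O κ hO _ fun δ hδ => ?_
      rw [← Fml.eval_subst]
      exact hv _ (Finset.mem_image_of_mem _ hδ)
  finitary Γ φ := by
    rintro ⟨Δ, hΔ, h⟩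
    exact ⟨Δ, hΔ, Δ, subset_rfl, h⟩

section

variable {C : Type} {L : Set (Fml C) → Fml C → Prop}

theorem IsLogic.mono (hL : IsLogic L) {Γ Δ : Set (Fml C)} {φ : Fml C} (h : Γ ⊆ Δ) (hφ : L Γ φ) :
    L Δ φ :=
  hL.cut Δ Γ φ (fun ψ hψ => hL.refl Δ ψ (h hψ)) hφ

theorem IsLogic.axExt (hL : IsLogic L) (S : Set (Fml C)) : IsLogic (axExt L S) where
  refl Γ φ h := hL.refl _ _ (Or.inl h)
  cut Γ Δ φ hΔ h := by
    refine hL.cut _ _ _ ?_ h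
    rintro ψ (hψ | hψ)
    · exact hΔ ψ hψ
    · exact hL.refl _ _ (Or.inr hψ)
  subst σ Γ φ h := by
    refine hL.mono ?_ (hL.subst σ _ _ h)
    rintro _ ⟨χ, hχ | ⟨ψ, hψ, τ, rfl⟩, rfl⟩
    · exact Or.inl ⟨χ, hχ, rfl⟩
    · exact Or.inr ⟨ψ, hψ, _, Fml.subst_subst _ _ _⟩
  finitary Γ φ h := by
    classical
    obtain ⟨Δ, hΔ, hφ⟩ := hL.finitary _ _ h
    refine ⟨Δ.filter (· ∈ Γ), fun χ hχ => (Finset.mem_filter.1 hχ).2, hL.mono (fun χ hχ => ?_) hφ⟩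
    rcases hΔ hχ with h | h
    · exact Or.inl (Finset.mem_coe.2 (Finset.mem_filter.2 ⟨hχ, h⟩))
    · exact Or.inr h

variable {R : Set (PropRule C)}

theorem AddRules.cut {Γ Δ : Set (Fml C)} {φ : Fml C} (hΔ : ∀ ψ ∈ Δ, AddRules L R Γ ψ)
    (h : AddRules L R Δ φ) : AddRules L R Γ φ := by
  induction h with
  | hyp φ h => exact hΔ φ h
  | base Θ φ _ h ih => exact .base Θ φ ih h
  | rule ρ hρ σ _ ih => exact .rule ρ hρ σ ih

theorem AddRules.mono {Γ Δ : Set (Fml C)} {φ : Fml C} (hΓ : Γ ⊆ Δ) (h : AddRules L R Γ φ) :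
    AddRules L R Δ φ :=
  h.cut fun ψ hψ => .hyp ψ (hΓ hψ)

theorem AddRules.exists_common {Γ : Set (Fml C)} (Δ : Finset (Fml C))
    (h : ∀ δ ∈ Δ, ∃ Θ : Finset (Fml C), ↑Θ ⊆ Γ ∧ AddRules L R ↑Θ δ) :
    ∃ Θ : Finset (Fml C), ↑Θ ⊆ Γ ∧ ∀ δ ∈ Δ, AddRules L R ↑Θ δ := by
  classical
  choose! F hF hF' using h
  refine ⟨Δ.biUnion F, ?_, fun δ hδ => (hF' δ hδ).mono fun χ hχ =>
    Finset.mem_coe.2 (Finset.mem_biUnion.2 ⟨δ, hδ, hχ⟩)⟩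
  intro χ hχ
  obtain ⟨δ, hδ, hχ⟩ := Finset.mem_biUnion.1 (Finset.mem_coe.1 hχ)
  exact hF δ hδ hχ

theorem IsLogic.addRules (hL : IsLogic L) (R : Set (PropRule C)) : IsLogic (AddRules L R) where
  refl Γ φ h := .hyp φ h
  cut Γ Δ φ hΔ h := h.cut hΔ
  subst σ Γ φ h := by
    induction h with
    | hyp φ h => exact .hyp _ ⟨φ, h, rfl⟩
    | base Θ φ _ h ih =>
      refine .base _ _ ?_ (hL.subst σ _ _ h)
      rintro _ ⟨χ, hχ, rfl⟩
      exact ih χ hχ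
    | rule ρ hρ τ _ ih =>
      rw [Fml.subst_subst]
      refine .rule ρ hρ _ fun γ hγ => ?_
      rw [← Fml.subst_subst]
      exact ih γ hγ
  finitary Γ φ h := by
    classical
    induction h with
    | hyp φ h => exact ⟨{φ}, by simpa using h, .hyp φ (by simp)⟩
    | base Θ φ _ h ih =>
      obtain ⟨Δ, hΔ, hφ⟩ := hL.finitary _ _ h
      obtain ⟨Ξ, hΞ, h'⟩ := AddRules.exists_common Δ fun δ hδ => ih δ (hΔ hδ)
      exact ⟨Ξ, hΞ, .base _ _ h' hφ⟩
    | rule ρ hρ τ _ ih =>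
      obtain ⟨Ξ, hΞ, h'⟩ := AddRules.exists_common (L := L) (R := R) (Γ := Γ)
        (ρ.1.image (Fml.subst τ)) fun δ hδ => by
          obtain ⟨γ, hγ, rfl⟩ := Finset.mem_image.1 hδ
          exact ih γ hγ
      exact ⟨Ξ, hΞ, .rule ρ hρ τ fun γ hγ => h' _ (Finset.mem_image_of_mem _ hγ)⟩

end

/-! ### The formulas `chainBound` -/

theorem eval_bigJoin_eq_one (κ : RatUnit → UnitI) (v : ℕ → UnitI) (l : List RFml) :
    (Fml.bigJoin l).eval standardGodel κ v = 1 ↔ ∃ φ ∈ l, φ.eval standardGodel κ v = 1 := by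
  induction l with
  | nil =>
    simp only [List.not_mem_nil, false_and, exists_false, iff_false]
    exact zero_ne_one
  | cons a l ih =>
    have : (Fml.bigJoin (a :: l)).eval standardGodel κ v =
        max (a.eval standardGodel κ v) ((Fml.bigJoin l).eval standardGodel κ v) := rfl
    rw [this]
    have hmax : ∀ x y : UnitI, max x y = 1 ↔ x = 1 ∨ y = 1 := fun x y => by
      rcases max_choice x y with h | h
      · rw [h]
        refine ⟨Or.inl, ?_⟩
        rintro (h' | h')
        · exact h'
        · exact le_antisymm unitInterval.le_one' (h' ▸ max_eq_left_iff.1 h)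
      · rw [h]
        refine ⟨Or.inr, ?_⟩
        rintro (h' | h')
        · exact le_antisymm unitInterval.le_one' (h' ▸ max_eq_right_iff.1 h)
        · exact h'
    rw [hmax, ih]
    simp

theorem eval_iff_eq_one (κ : RatUnit → UnitI) (v : ℕ → UnitI) (φ ψ : RFml) :
    (Fml.iff φ ψ).eval standardGodel κ v = 1 ↔
      φ.eval standardGodel κ v = ψ.eval standardGodel κ v := by
  change min (standardGodel.imp _ _) (standardGodel.imp _ _) = 1 ↔ _
  constructor
  · intro h
    have h1 : ∀ x : UnitI, 1 ≤ x → x = 1 := fun x hx => le_antisymm unitInterval.le_one' hx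
    exact le_antisymm (standardGodel_imp_eq_one.1 (h1 _ (h ▸ min_le_left _ _)))
      (standardGodel_imp_eq_one.1 (h1 _ (h ▸ min_le_right _ _)))
  · intro h
    rw [h, standardGodel_imp_of_le le_rfl, min_self]

theorem eval_chainBound_eq_one (κ : RatUnit → UnitI) (v : ℕ → UnitI) (p : RatUnit) (n : ℕ) :
    (chainBound p n).eval standardGodel κ v = 1 ↔
      ∃ j < n + 3, ∃ i < j, max (κ p) (v i) = max (κ p) (v j) := by
  unfold chainBound
  rw [eval_bigJoin_eq_one]
  simp only [List.mem_flatMap, List.mem_range, List.mem_map]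
  constructor
  · rintro ⟨φ, ⟨j, hj, i, hi, rfl⟩, h⟩
    exact ⟨j, hj, i, hi, (eval_iff_eq_one _ _ _ _).1 h⟩
  · rintro ⟨j, hj, i, hi, h⟩
    exact ⟨_, ⟨j, hj, i, hi, rfl⟩, (eval_iff_eq_one _ _ _ _).2 h⟩

/-- If `max (κ p) (v i)` takes at most `n + 2` values, then `chainBound p n` holds. -/
theorem eval_chainBound_of_card {κ : RatUnit → UnitI} {v : ℕ → UnitI} {p : RatUnit} {n : ℕ}
    {H : Finset UnitI} (hH : H.card ≤ n + 2) (h : ∀ i, max (κ p) (v i) ∈ H) :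
    (chainBound p n).eval standardGodel κ v = 1 := by
  rw [eval_chainBound_eq_one]
  obtain ⟨i, hi, j, hj, hij, he⟩ := Finset.exists_ne_map_eq_of_card_lt_of_maps_to
    (s := Finset.range (n + 3)) (t := H) (by rw [Finset.card_range]; omega)
    (f := fun i => max (κ p) (v i)) (fun i _ => h i)
  rw [Finset.mem_range] at hi hj
  rcases lt_or_gt_of_ne hij with h' | h'
  · exact ⟨j, hj, i, h', he⟩
  · exact ⟨i, hi, j, h', he.symm⟩

/-! ### The interpretation of the constants that collapses those outside a lower set -/

/-- A rational number in `[0, 1]`, as an element of the real unit interval. -/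
def ratPoint (q : RatUnit) : UnitI :=
  ⟨((q : ℚ) : ℝ), by exact_mod_cast q.2.1, by exact_mod_cast q.2.2⟩

theorem ratPoint_lt {p q : RatUnit} : ratPoint p < ratPoint q ↔ p < q := by
  rw [← Subtype.coe_lt_coe, ← Subtype.coe_lt_coe]
  exact Rat.cast_lt

theorem ratPoint_le {p q : RatUnit} : ratPoint p ≤ ratPoint q ↔ p ≤ q := by
  rw [← not_lt, ratPoint_lt, not_lt]

theorem ratPoint_zero : ratPoint 0 = 0 := Subtype.ext Rat.cast_zero

theorem ratPoint_one : ratPoint 1 = 1 := Subtype.ext Rat.cast_one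

open Classical in
/-- The constants in `D` are interpreted by themselves, the other ones by `1`. -/
noncomputable def constIn (D : Set RatUnit) (q : RatUnit) : UnitI :=
  if q ∈ D then ratPoint q else 1

/-- The axioms that collapse the constants outside `D` and, if `γ` is finite, bound the number of
elements above `c_p`. -/
def collapseAxioms (D : Set RatUnit) (p : RatUnit) (γ : ℕ∞) : Set RFml :=
  {φ | ∃ q, q ∉ D ∧ φ = Fml.const q} ∪ {φ | ∃ n : ℕ, γ = (n : ℕ∞) ∧ φ = chainBound p n}

/-- The extension of rational Gödel logic by `collapseAxioms`. -/
def collapseLogic (D : Set RatUnit) (p : RatUnit) (γ : ℕ∞) : Set RFml → RFml → Prop :=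
  axExt RG (collapseAxioms D p γ)

/-- The rules `c_q ∨ z ▷ z` for `q ∈ Q`. -/
def constRules (Q : Set RatUnit) : Set (PropRule RatUnit) := {ρ | ∃ q ∈ Q, ρ = constRule q}

/-- `D` is a proper lower set of constants in which `Q` is cofinal, with maximum `p` if `γ` is
finite. -/
structure CollapseData (D Q : Set RatUnit) (p : RatUnit) (γ : ℕ∞) : Prop where
  lower : ∀ s t, s ≤ t → t ∈ D → s ∈ D
  zero_mem : 0 ∈ D
  one_notMem : 1 ∉ D
  subset : Q ⊆ D
  cofinal : ∀ s ∈ D, ∃ q ∈ Q, s ≤ q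
  greatest : ∀ n : ℕ, γ = n → p ∈ D ∧ ∀ q ∈ D, q ≤ p

/-- The assignment `v` takes few values above `p`. -/
def FewAbove (p : RatUnit) (γ : ℕ∞) (v : ℕ → UnitI) : Prop :=
  ∀ n : ℕ, γ = n → ∃ H : Finset UnitI, H.card ≤ n + 2 ∧ ratPoint p ∈ H ∧ 1 ∈ H ∧
    ∀ i, max (ratPoint p) (v i) ∈ H

section

variable {D Q : Set RatUnit} {p : RatUnit} {γ : ℕ∞}

theorem constIn_of_mem {q : RatUnit} (h : q ∈ D) : constIn D q = ratPoint q := if_pos h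

theorem constIn_of_notMem {q : RatUnit} (h : q ∉ D) : constIn D q = 1 := if_neg h

theorem ratPoint_le_constIn (D : Set RatUnit) (q : RatUnit) : ratPoint q ≤ constIn D q := by
  by_cases h : q ∈ D
  · rw [constIn_of_mem h]
  · rw [constIn_of_notMem h]
    exact unitInterval.le_one'

/-! ### Soundness in the reference model -/

namespace CollapseData

theorem lt_one (hD : CollapseData D Q p γ) {q : RatUnit} (h : q ∈ D) : ratPoint q < 1 := by
  rw [← ratPoint_one, ratPoint_lt]
  refine lt_of_le_of_ne q.2.2 ?_
  rintro rfl
  exact hD.one_notMem h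

theorem prec_constIn (hD : CollapseData D Q p γ) {s t : RatUnit} (h : s < t) :
    Prec (constIn D s) (constIn D t) := by
  by_cases ht : t ∈ D
  · rw [constIn_of_mem ht, constIn_of_mem (hD.lower s t h.le ht)]
    exact Or.inl (ratPoint_lt.2 h)
  · rw [constIn_of_notMem ht]
    exact prec_one _

theorem respectsOn_constIn (hD : CollapseData D Q p γ) (S : Finset RatUnit) :
    RespectsOn S (constIn D) where
  zero := by rw [constIn_of_mem hD.zero_mem, ratPoint_zero]
  one := constIn_of_notMem hD.one_notMem
  prec _ _ _ _ h := hD.prec_constIn h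

theorem isRationalGodelAlgebra (hD : CollapseData D Q p γ) :
    IsRationalGodelAlgebra standardGodel (constIn D) where
  godel _ _ h := h
  const_zero := (hD.respectsOn_constIn ∅).zero
  const_one := (hD.respectsOn_constIn ∅).one
  const_mul s t := by
    change min _ _ = _
    rcases lt_trichotomy s t with h | rfl | h
    · rw [min_eq_left h.le, min_eq_left (hD.prec_constIn h).le]
    · rw [min_self, min_self]
    · rw [min_eq_right h.le, min_eq_right (hD.prec_constIn h).le]
  const_imp s t := by
    have h1 := (hD.respectsOn_constIn ∅).one
    rcases lt_trichotomy s t with h | rfl | h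
    · rw [if_pos h.le, h1, standardGodel_imp_of_le (hD.prec_constIn h).le]
    · rw [if_pos le_rfl, h1, standardGodel_imp_of_le le_rfl]
    · rw [if_neg (not_le.2 h)]
      rcases hD.prec_constIn h with h' | ⟨h2, h3⟩
      · exact standardGodel_imp_of_lt h'
      · rw [h2, h3, standardGodel_imp_of_le le_rfl]

/-- If an assignment takes few values above `p`, then so do all formulas. -/
theorem eval_mem (hD : CollapseData D Q p γ) {n : ℕ} (hn : γ = n) {v : ℕ → UnitI}
    {H : Finset UnitI} (hp : ratPoint p ∈ H) (h1 : 1 ∈ H)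
    (hv : ∀ i, max (ratPoint p) (v i) ∈ H) (φ : RFml) :
    max (ratPoint p) (φ.eval standardGodel (constIn D) v) ∈ H := by
  -- Equality restricted to a set is such a relation, so the points whose maximum with `p` lies in
  -- `H` are closed under the operations.
  have hr : ChainRel fun a a' => a = a' ∧ max (ratPoint p) a ∈ H :=
    { zero := ⟨rfl, by rwa [max_eq_left unitInterval.nonneg']⟩
      one := ⟨rfl, by rwa [max_eq_right unitInterval.le_one']⟩
      prec := by
        rintro a _ b _ ⟨rfl, -⟩ ⟨rfl, -⟩ h
        exact Or.inl h
      unique := by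
        rintro a _ _ - ⟨rfl, -⟩ ⟨rfl, -⟩
        rfl }
  refine (hr.eval φ (κ' := constIn D) (v' := v) (fun c _ => ⟨rfl, ?_⟩) fun i _ => ⟨rfl, hv i⟩).2
  by_cases hc : c ∈ D
  · rwa [constIn_of_mem hc, max_eq_left (ratPoint_le.2 ((hD.greatest n hn).2 c hc))]
  · rwa [constIn_of_notMem hc, max_eq_right unitInterval.le_one']

theorem sound (hD : CollapseData D Q p γ) {v : ℕ → UnitI} (hv : FewAbove p γ v) {Γ : Set RFml}
    {φ : RFml} (h : collapseLogic D p γ Γ φ)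
    (hΓ : ∀ ψ ∈ Γ, ψ.eval standardGodel (constIn D) v = 1) :
    φ.eval standardGodel (constIn D) v = 1 := by
  obtain ⟨Δ, hΔ, h⟩ := h
  refine h UnitI standardGodel _ hD.isRationalGodelAlgebra v fun δ hδ => ?_
  rcases hΔ hδ with h | ⟨ψ, ⟨q, hq, rfl⟩ | ⟨n, hn, rfl⟩, σ, rfl⟩
  · exact hΓ δ h
  · exact constIn_of_notMem hq
  · rw [Fml.eval_subst]
    obtain ⟨H, hcard, hp, h1, hH⟩ := hv n hn
    refine eval_chainBound_of_card hcard fun i => ?_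
    rw [constIn_of_mem (hD.greatest n hn).1]
    exact hD.eval_mem hn hp h1 hH _

/-- In a chain, `c_q ∨ z` is 1 only if one of the two is, and the constants in `Q ⊆ D` stay below 1.
-/
theorem sound_addRules (hD : CollapseData D Q p γ) {v : ℕ → UnitI} (hv : FewAbove p γ v)
    {Γ : Set RFml} {φ : RFml} (h : AddRules (collapseLogic D p γ) (constRules Q) Γ φ)
    (hΓ : ∀ ψ ∈ Γ, ψ.eval standardGodel (constIn D) v = 1) :
    φ.eval standardGodel (constIn D) v = 1 := by
  induction h with
  | hyp φ h => exact hΓ φ h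
  | base Δ φ _ h ih => exact hD.sound hv h ih
  | rule ρ hρ σ _ ih =>
    obtain ⟨q, hq, rfl⟩ := hρ
    have h1 := ih _ (Finset.mem_singleton_self _)
    change max (constIn D q) _ = 1 at h1
    rw [constIn_of_mem (hD.subset hq)] at h1
    rcases max_choice (ratPoint q) ((σ 0).eval standardGodel (constIn D) v) with h2 | h2
    · exact absurd (h2.symm.trans h1) (hD.lt_one (hD.subset hq)).ne
    · exact h2.symm.trans h1

end CollapseData

/-! ### Refuting a consequence in a finite part of a chain -/

-- Compactness: finitely many instances of the axioms serve as premises, namely the constants in `S`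
-- outside `D` and the instances of `chainBound` at all tuples from `W`. If the formulas in `W` took
-- `n + 3` distinct values above `p`, the instance at a corresponding tuple would fail.
open Classical in
theorem exists_refutation {Γ : Finset RFml} {φ : RFml} (hL : ¬ collapseLogic D p γ ↑Γ φ)
    (S : Finset RatUnit) (W : Finset RFml) :
    ∃ κ v, RespectsOn S κ ∧ (∀ s ∈ S, s ∉ D → κ s = 1) ∧
      (∀ n : ℕ, γ = n →
        (W.image fun ψ => max (κ p) (ψ.eval standardGodel κ v)).card ≤ n + 2) ∧
      (∀ ψ ∈ Γ, ψ.eval standardGodel κ v = 1) ∧ φ.eval standardGodel κ v ≠ 1 := by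
  by_contra hcon
  push Not at hcon
  set N : Finset ℕ := if γ = ⊤ then ∅ else {γ.toNat} with hN
  -- Variables from `n + 3` on do not occur in `chainBound p n`; their image is arbitrary.
  let τ : (n : ℕ) → (Fin (n + 3) → W) → ℕ → RFml :=
    fun n g i => if h : i < n + 3 then (g ⟨i, h⟩ : RFml) else .one
  refine hL (RG_of_standard S (Γ ∪ (S.filter (· ∉ D)).image Fml.const ∪ N.biUnion fun n =>
    Finset.univ.image fun g : Fin (n + 3) → W => (chainBound p n).subst (τ n g)) φ
    (fun κ v hκ hv => ?_) ?_)
  · refine hcon κ v hκ (fun s hs hsD => ?_) (fun n hn => ?_) (fun ψ hψ => ?_)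
    · exact hv (.const s) (by simp [hs, hsD])
    · by_contra hlt
      rw [not_le] at hlt
      obtain ⟨e⟩ : Nonempty (Fin (n + 3) ↪
          ↥(W.image fun ψ => max (κ p) (ψ.eval standardGodel κ v))) := by
        rw [Function.Embedding.nonempty_iff_card_le]
        simp only [Fintype.card_fin, Fintype.card_coe]
        exact hlt
      have hpre : ∀ i, ∃ ψ : W, max (κ p) ((ψ : RFml).eval standardGodel κ v) = e i := fun i => by
        obtain ⟨ψ, hψ, h⟩ := Finset.mem_image.1 (e i).2
        exact ⟨⟨ψ, hψ⟩, h⟩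
      choose g hg using hpre
      have h1 := hv ((chainBound p n).subst (τ n g)) (by
        refine Finset.mem_union_right _ (Finset.mem_biUnion.2 ⟨n, ?_, ?_⟩)
        · simp [hN, hn]
        · exact Finset.mem_image_of_mem _ (Finset.mem_univ g))
      rw [Fml.eval_subst, eval_chainBound_eq_one] at h1
      obtain ⟨j, hj, i, hij, h2⟩ := h1
      have hi : i < n + 3 := hij.trans hj
      simp only [τ, hj, hi, dif_pos, hg] at h2
      have h3 := e.injective (Subtype.ext h2)
      simp only [Fin.mk.injEq] at h3
      omega
    · exact hv ψ (by simp [hψ])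
  · intro χ hχ
    simp only [Finset.coe_union, Set.mem_union, Finset.mem_coe] at hχ
    rcases hχ with (hχ | hχ) | hχ
    · exact Or.inl hχ
    · obtain ⟨s, hs, rfl⟩ := Finset.mem_image.1 hχ
      exact Or.inr ⟨.const s, Or.inl ⟨s, (Finset.mem_filter.1 hs).2, rfl⟩, .var, rfl⟩
    · obtain ⟨n, hn, hχ⟩ := Finset.mem_biUnion.1 hχ
      obtain ⟨g, -, rfl⟩ := Finset.mem_image.1 hχ
      refine Or.inr ⟨chainBound p n, Or.inr ⟨n, ?_, rfl⟩, _, rfl⟩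
      rw [hN] at hn
      split_ifs at hn with hγ
      · simp at hn
      · rw [Finset.mem_singleton.1 hn, ENat.natCast_toNat hγ]

/-! ### Rational copies of finite chains -/

/-- Points are inserted one by one, using that `ℚ` is dense without endpoints. -/
theorem exists_strictMonoOn_extension {α : Type*} [LinearOrder α] (S T : Finset α) (f : α → ℚ)
    (hf : StrictMonoOn f S) : ∃ g : α → ℚ, StrictMonoOn g ↑(S ∪ T) ∧ Set.EqOn g f S := by
  classical
  induction T using Finset.induction_on with
  | empty => exact ⟨f, by simpa using hf, fun _ _ => rfl⟩
  | insert a T _ ih =>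
    obtain ⟨g, hg, hgf⟩ := ih
    by_cases ha : a ∈ S ∪ T
    · refine ⟨g, ?_, hgf⟩
      rwa [Finset.union_insert, Finset.insert_eq_self.2 ha]
    obtain ⟨m, hm, hm'⟩ := Order.exists_between_finsets
      (lo := ((S ∪ T).filter (· < a)).image g) (hi := ((S ∪ T).filter (a < ·)).image g) (by
        simp only [Finset.mem_image, Finset.mem_filter]
        rintro _ ⟨x, ⟨hx, hxa⟩, rfl⟩ _ ⟨y, ⟨hy, hay⟩, rfl⟩
        exact hg hx hy (hxa.trans hay))
    refine ⟨Function.update g a m, ?_, fun x hx => ?_⟩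
    · intro x hx y hy hxy
      rw [Finset.union_insert, Finset.mem_coe, Finset.mem_insert] at hx hy
      rcases hx with rfl | hx <;> rcases hy with rfl | hy
      · exact absurd hxy (lt_irrefl _)
      · rw [Function.update_self, Function.update_of_ne hxy.ne']
        exact hm' _ (Finset.mem_image_of_mem _ (Finset.mem_filter.2 ⟨hy, hxy⟩))
      · rw [Function.update_self, Function.update_of_ne hxy.ne]
        exact hm _ (Finset.mem_image_of_mem _ (Finset.mem_filter.2 ⟨hx, hxy⟩))
      · rw [Function.update_of_ne (ne_of_mem_of_not_mem hx ha),
          Function.update_of_ne (ne_of_mem_of_not_mem hy ha)]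
        exact hg hx hy hxy
    · rw [Function.update_of_ne, hgf hx]
      rintro rfl
      exact ha (Finset.mem_union_left _ hx)

-- `u` is the least constant in `S` with value 1. The constants below it have distinct values, so
-- returning each value to its name and sending 1 to `u` is strictly increasing, and this extends to
-- the points of `T`.
open Classical in
theorem RespectsOn.exists_embedding {S : Finset RatUnit} {κ : RatUnit → UnitI}
    (hκ : RespectsOn S κ) (h0 : 0 ∈ S) (h1 : 1 ∈ S) (T : Finset UnitI) :
    ∃ (u : RatUnit) (f : UnitI → RatUnit), (∀ s ∈ S, κ s = 1 ↔ u ≤ s) ∧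
      StrictMonoOn f ↑(T ∪ S.image κ) ∧ f 1 = u ∧ ∀ s ∈ S, s < u → f (κ s) = s := by
  have hne : (S.filter (κ · = 1)).Nonempty := ⟨1, by simp [h1, hκ.one]⟩
  set u := (S.filter (κ · = 1)).min' hne with hu
  obtain ⟨huS, huκ⟩ := Finset.mem_filter.1 (Finset.min'_mem _ hne)
  rw [← hu] at huS huκ
  have hiff : ∀ s ∈ S, κ s = 1 ↔ u ≤ s := by
    refine fun s hs => ⟨fun h => Finset.min'_le _ _ (by simp [hs, h]), fun h => ?_⟩
    rcases eq_or_lt_of_le h with rfl | h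
    · exact huκ
    · rcases hκ.prec u huS s hs h with h' | h'
      · exact absurd (huκ ▸ h') (not_lt.2 unitInterval.le_one')
      · exact h'.2
  have hmono : ∀ s ∈ S, ∀ t ∈ S, s < u → s < t → κ s < κ t := fun s hs t ht hsu hst => by
    rcases hκ.prec s hs t ht hst with h | ⟨h, -⟩
    · exact h
    · exact absurd ((hiff s hs).1 h) (not_le.2 hsu)
  let f : UnitI → RatUnit := fun a => if h : ∃ s ∈ S, s < u ∧ κ s = a then h.choose else u
  have hf : ∀ s ∈ S, s < u → f (κ s) = s := by
    intro s hs hsu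
    have hex : ∃ t ∈ S, t < u ∧ κ t = κ s := ⟨s, hs, hsu, rfl⟩
    have h2 := hex.choose_spec
    simp only [f, dif_pos hex]
    rcases lt_trichotomy hex.choose s with h | h | h
    · exact absurd h2.2.2 (hmono _ h2.1 _ hs h2.2.1 h).ne
    · exact h
    · exact absurd h2.2.2 (hmono _ hs _ h2.1 hsu h).ne'
  have hf1 : f 1 = u := by
    refine dif_neg ?_
    rintro ⟨s, hs, hsu, h⟩
    exact absurd ((hiff s hs).1 h) (not_le.2 hsu)
  have hfm : StrictMonoOn (fun a => (f a : ℚ)) ↑(S.image κ) := by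
    intro a ha b hb hab
    obtain ⟨s, hs, rfl⟩ := Finset.mem_image.1 (Finset.mem_coe.1 ha)
    obtain ⟨t, ht, rfl⟩ := Finset.mem_image.1 (Finset.mem_coe.1 hb)
    have hsu : s < u := not_le.1 fun h =>
      not_lt.2 unitInterval.le_one' (((hiff s hs).2 h) ▸ hab)
    change f (κ s) < f (κ t)
    rw [hf s hs hsu]
    rcases lt_or_ge t u with htu | htu
    · rw [hf t ht htu]
      rcases lt_trichotomy s t with h | rfl | h
      · exact h
      · exact absurd hab (lt_irrefl _)
      · exact absurd (hmono t ht s hs htu h) (not_lt.2 hab.le)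
    · rwa [(hiff t ht).2 htu, hf1]
  obtain ⟨g, hg, hgf⟩ := exists_strictMonoOn_extension (S.image κ) T _ hfm
  rw [Finset.union_comm] at hg
  have hmem : ∀ s ∈ S, κ s ∈ S.image κ := fun s hs => Finset.mem_image_of_mem _ hs
  have hu0 : 0 < u := lt_of_le_of_ne u.2.1 fun h => by
    have := (hiff 0 h0).2 h.symm.le
    rw [hκ.zero] at this
    exact zero_ne_one this
  have hrange : ∀ a ∈ T ∪ S.image κ, g a ∈ Set.Icc (0 : ℚ) 1 := fun a ha => by
    have hg0 : g 0 = 0 := by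
      have := hgf (hmem 0 h0)
      dsimp only at this
      rw [hf 0 h0 hu0, hκ.zero] at this
      exact this
    have hg1 : g 1 ≤ 1 := by
      have := hgf (hmem 1 h1)
      rw [hκ.one] at this
      rw [this]
      exact (f 1).2.2
    constructor
    · rw [← hg0]
      refine hg.monotoneOn ?_ ha unitInterval.nonneg'
      have := Finset.mem_union_right T (hmem 0 h0)
      rwa [hκ.zero] at this
    · refine (hg.monotoneOn ha ?_ unitInterval.le_one').trans hg1
      have := Finset.mem_union_right T (hmem 1 h1)
      rwa [hκ.one] at this
  have hproj : ∀ s ∈ S, Set.projIcc (0 : ℚ) 1 zero_le_one (g (κ s)) = f (κ s) := fun s hs => by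
    rw [hgf (hmem s hs)]
    exact Set.projIcc_val _ _
  refine ⟨u, fun a => Set.projIcc (0 : ℚ) 1 zero_le_one (g a), hiff, ?_, ?_, ?_⟩
  · intro a ha b hb hab
    exact Set.strictMonoOn_projIcc zero_le_one (hrange a ha) (hrange b hb) (hg ha hb hab)
  · have := hproj 1 h1
    rw [hκ.one] at this
    exact this.trans hf1
  · exact fun s hs hsu => (hproj s hs).trans (hf s hs hsu)

/-- The predicate `P` gives the admitted images of 1. It is used with the upper set of `u`, to
transfer falsity, and with `{1}`, to transfer truth. -/
theorem chainRel_of_strictMonoOn {T : Set UnitI} {f : UnitI → RatUnit} (hf : StrictMonoOn f T)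
    (hT0 : 0 ∈ T) (hT1 : 1 ∈ T) (hf0 : f 0 = 0) {P : UnitI → Prop} (hP1 : P 1)
    (hP : ∀ a, P a → ratPoint (f 1) ≤ a) :
    ChainRel fun a a' => (a = 1 ∧ P a') ∨ (a ≠ 1 ∧ a ∈ T ∧ a' = ratPoint (f a)) where
  zero := Or.inr ⟨zero_ne_one, hT0, by rw [hf0, ratPoint_zero]⟩
  one := Or.inl ⟨rfl, hP1⟩
  prec := by
    rintro a a' b b' (⟨rfl, -⟩ | ⟨ha, haT, rfl⟩) (⟨rfl, hb⟩ | ⟨hb, hbT, rfl⟩) h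
    · exact absurd h (lt_irrefl _)
    · exact absurd h (not_lt.2 unitInterval.le_one')
    · exact Or.inl ((ratPoint_lt.2 (hf haT hT1 h)).trans_le (hP b' hb))
    · exact Or.inl (ratPoint_lt.2 (hf haT hbT h))
  unique := by
    rintro a a' b' ha (⟨rfl, -⟩ | ⟨-, -, rfl⟩) (⟨h, -⟩ | ⟨-, -, rfl⟩)
    · exact absurd rfl ha
    · exact absurd rfl ha
    · exact absurd h ha
    · rfl

end

/-! ### Moving refutations into the reference model -/

section

variable {D Q : Set RatUnit} {p : RatUnit} {γ : ℕ∞}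

open Classical in
/-- A non-derivable consequence is refuted in a finite part `κ, v` of a chain, and this has a copy
`v'` with rational values in the chain in which precisely the constants in `D` do not collapse. -/
theorem exists_rational_model {Γ : Finset RFml} {φ : RFml}
    (hL : ¬ collapseLogic D p γ ↑Γ φ) (S : Finset RatUnit) (V : Finset ℕ) (h0 : 0 ∈ S) (h1 : 1 ∈ S)
    (hp : ∀ n : ℕ, γ = n → p ∈ S) :
    ∃ (κ : RatUnit → UnitI) (v v' : ℕ → UnitI), RespectsOn S κ ∧
      (∀ ψ ∈ Γ, ψ.eval standardGodel κ v = 1) ∧ φ.eval standardGodel κ v ≠ 1 ∧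
      (∀ i, ∃ q, v' i = ratPoint q) ∧ (∀ i ∉ V, v' i = 1) ∧ FewAbove p γ v' ∧
      ∀ ψ : RFml, ψ.consts ⊆ S → ψ.vars ⊆ V →
        (ψ.eval standardGodel κ v ≠ 1 → ψ.eval standardGodel (constIn D) v' ≠ 1) ∧
        ((∀ s ∈ S, s ∈ D → κ s ≠ 1) → ψ.eval standardGodel κ v = 1 →
          ψ.eval standardGodel (constIn D) v' = 1) := by
  obtain ⟨κ, v, hκ, hκD, hcard, hΓ, hφ⟩ :=
    exists_refutation hL S (V.image Fml.var ∪ {.const p, .one})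
  obtain ⟨u, f, hu, hf, hf1, hfS⟩ := hκ.exists_embedding h0 h1 (V.image v)
  set T := V.image v ∪ S.image κ with hT
  have hTS : ∀ s ∈ S, κ s ∈ T := fun s hs =>
    Finset.mem_union_right _ (Finset.mem_image_of_mem _ hs)
  have hTV : ∀ i ∈ V, v i ∈ T := fun i hi =>
    Finset.mem_union_left _ (Finset.mem_image_of_mem _ hi)
  have hT0 : (0 : UnitI) ∈ T := hκ.zero ▸ hTS 0 h0
  have hT1 : (1 : UnitI) ∈ T := hκ.one ▸ hTS 1 h1
  have hu0 : 0 < u := not_le.1 fun h => by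
    have := (hu 0 h0).2 h
    rw [hκ.zero] at this
    exact zero_ne_one this
  have hf0 : f 0 = 0 := hκ.zero ▸ hfS 0 h0 hu0
  have hDS : ∀ s ∈ S, s < u → s ∈ D := fun s hs hsu => by
    by_contra h
    exact absurd ((hu s hs).1 (hκD s hs h)) (not_le.2 hsu)
  set v' : ℕ → UnitI := fun i => if i ∈ V ∧ v i ≠ 1 then ratPoint (f (v i)) else 1 with hv'
  have hv'1 : ∀ i, v' i = 1 ∨ (i ∈ V ∧ v i ≠ 1 ∧ v' i = ratPoint (f (v i))) := fun i => by
    by_cases h : i ∈ V ∧ v i ≠ 1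
    · exact Or.inr ⟨h.1, h.2, if_pos h⟩
    · exact Or.inl (if_neg h)
  have hflt : ∀ a ∈ T, a ≠ 1 → ratPoint (f a) < ratPoint u := fun a ha ha1 => by
    rw [ratPoint_lt, ← hf1]
    exact hf ha hT1 (lt_of_le_of_ne unitInterval.le_one' ha1)
  have hconst : ∀ c ∈ S, κ c ≠ 1 → constIn D c = ratPoint (f (κ c)) := fun c hc hc1 => by
    have hcu : c < u := not_le.1 fun h => hc1 ((hu c hc).2 h)
    rw [constIn_of_mem (hDS c hc hcu), hfS c hc hcu]
  have hone : ∀ q, ratPoint q ≤ 1 := fun q => unitInterval.le_one'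
  refine ⟨κ, v, v', hκ, hΓ, hφ, fun i => ?_, fun i hi => if_neg fun h => hi h.1, fun n hn => ?_,
    fun ψ hψS hψV => ⟨fun h => ?_, fun hS h => ?_⟩⟩
  · rcases hv'1 i with h | ⟨-, -, h⟩
    · exact ⟨1, h.trans ratPoint_one.symm⟩
    · exact ⟨_, h⟩
  · have hpS := hp n hn
    -- If `c_p` collapses then `u ≤ p`, so all values of `v'` other than 1 lie below `p`, and two
    -- points suffice. Otherwise the bound is carried over along `F`.
    by_cases hκp : κ p = 1
    · refine ⟨{ratPoint p, 1}, (Finset.card_le_two).trans (by omega), by simp, by simp,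
        fun i => ?_⟩
      rcases hv'1 i with h | ⟨hi, hi1, h⟩
      · rw [h, max_eq_right (hone p)]
        simp
      · rw [h, max_eq_left]
        · simp
        · exact (hflt _ (hTV i hi) hi1).le.trans (ratPoint_le.2 ((hu p hpS).1 hκp))
    · have hpu : p < u := not_le.1 fun h => hκp ((hu p hpS).2 h)
      set H := (V.image Fml.var ∪ {.const p, .one}).image fun ψ : RFml =>
        max (κ p) (ψ.eval standardGodel κ v)
      set F : UnitI → UnitI := fun a => if a = 1 then 1 else ratPoint (f a) with hF
      have hH : ∀ ψ ∈ V.image Fml.var ∪ {Fml.const p, Fml.one},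
          F (max (κ p) (ψ.eval standardGodel κ v)) ∈ H.image F := fun ψ hψ =>
        Finset.mem_image_of_mem _ (Finset.mem_image_of_mem _ hψ)
      have hFp : F (κ p) = ratPoint p := by
        rw [hF]
        simp only [if_neg hκp]
        rw [hfS p hpS hpu]
      have hHp := hH (.const p) (by simp)
      have hH1 := hH .one (by simp)
      change F (max (κ p) (κ p)) ∈ _ at hHp
      change F (max (κ p) 1) ∈ _ at hH1
      rw [max_self, hFp] at hHp
      rw [max_eq_right unitInterval.le_one', show F 1 = 1 from if_pos rfl] at hH1
      refine ⟨H.image F, Finset.card_image_le.trans (hcard n hn), hHp, hH1, fun i => ?_⟩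
      rcases hv'1 i with h | ⟨hi, hi1, h⟩
      · rwa [h, max_eq_right (hone p)]
      · have hHi := hH (.var i) (by simp [hi])
        change F (max (κ p) (v i)) ∈ _ at hHi
        have hFi : F (v i) = v' i := by
          rw [h]
          exact if_neg hi1
        rcases le_total (κ p) (v i) with hle | hle
        · rw [max_eq_right hle, hFi] at hHi
          rwa [max_eq_right]
          rw [h, ratPoint_le, ← hfS p hpS hpu]
          exact hf.monotoneOn (hTS p hpS) (hTV i hi) hle
        · rwa [max_eq_left]
          rw [h, ratPoint_le, ← hfS p hpS hpu]
          exact hf.monotoneOn (hTV i hi) (hTS p hpS) hle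
  -- A constant in `D` may have value 1 under `κ` but not under `constIn D`, so 1 is allowed any
  -- image from `u` upwards. Other points go strictly below `u`, hence stay different from 1.
  · have hr := chainRel_of_strictMonoOn (P := fun a => ratPoint u ≤ a) hf hT0 hT1 hf0 (hone u)
      (fun a ha => by rwa [hf1])
    have hc : ∀ c ∈ ψ.consts, (κ c = 1 ∧ ratPoint u ≤ constIn D c) ∨
        (κ c ≠ 1 ∧ κ c ∈ T ∧ constIn D c = ratPoint (f (κ c))) := fun c hc => by
      by_cases hc1 : κ c = 1
      · exact Or.inl ⟨hc1, (ratPoint_le.2 ((hu c (hψS hc)).1 hc1)).trans (ratPoint_le_constIn D c)⟩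
      · exact Or.inr ⟨hc1, hTS c (hψS hc), hconst c (hψS hc) hc1⟩
    have hi : ∀ i ∈ ψ.vars, (v i = 1 ∧ ratPoint u ≤ v' i) ∨
        (v i ≠ 1 ∧ v i ∈ T ∧ v' i = ratPoint (f (v i))) := fun i hi => by
      by_cases hi1 : v i = 1
      · exact Or.inl ⟨hi1, (hone u).trans_eq (if_neg fun h => h.2 hi1).symm⟩
      · exact Or.inr ⟨hi1, hTV i (hψV hi), if_pos ⟨hψV hi, hi1⟩⟩
    rcases hr.eval ψ hc hi with h' | ⟨-, hmem, h'⟩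
    · exact absurd h'.1 h
    · rw [h']
      exact ((hflt _ hmem h).trans_le (hone u)).ne
  · have hr := chainRel_of_strictMonoOn (P := fun a => a = 1) hf hT0 hT1 hf0 rfl
      (fun a ha => by rw [ha]; exact hone _)
    have hc : ∀ c ∈ ψ.consts, (κ c = 1 ∧ constIn D c = 1) ∨
        (κ c ≠ 1 ∧ κ c ∈ T ∧ constIn D c = ratPoint (f (κ c))) := fun c hc => by
      by_cases hc1 : κ c = 1
      · exact Or.inl ⟨hc1, constIn_of_notMem fun hcD => hS c (hψS hc) hcD hc1⟩
      · exact Or.inr ⟨hc1, hTS c (hψS hc), hconst c (hψS hc) hc1⟩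
    have hi : ∀ i ∈ ψ.vars, (v i = 1 ∧ v' i = 1) ∨
        (v i ≠ 1 ∧ v i ∈ T ∧ v' i = ratPoint (f (v i))) := fun i hi => by
      by_cases hi1 : v i = 1
      · exact Or.inl ⟨hi1, if_neg fun h => h.2 hi1⟩
      · exact Or.inr ⟨hi1, hTV i (hψV hi), if_pos ⟨hψV hi, hi1⟩⟩
    rcases hr.eval ψ hc hi with h' | ⟨hne, -⟩
    · exact h'.2
    · exact absurd h hne

/-- Adding the rules `c_q ∨ z ▷ z` for `q ∈ Q` yields no new theorems. -/
theorem CollapseData.theorem_of_addRules (hD : CollapseData D Q p γ) {φ : RFml}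
    (h : AddRules (collapseLogic D p γ) (constRules Q) ∅ φ) : collapseLogic D p γ ∅ φ := by
  classical
  by_contra hL
  rw [← Finset.coe_empty] at hL
  obtain ⟨κ, v, v', -, -, hφ, -, -, hv', hψ⟩ := exists_rational_model hL (φ.consts ∪ {0, 1, p}) φ.vars
    (by simp) (by simp) (by simp)
  -- Only falsity has to be transferred, so constants in `D` are allowed to collapse under `κ`.
  exact (hψ φ Finset.subset_union_left subset_rfl).1 hφ (hD.sound_addRules hv' h (by simp))

/-! ### Realizing a finite chain above a constant by formulas -/

/-- `c_u` followed by formulas whose values increase strictly until they reach `1`. -/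
def chainFml (u : RatUnit) : ℕ → RFml
  | 0 => .const u
  | j + 1 => .join (.imp (.var j) (chainFml u j)) (.var j)

theorem prec_chainFml_succ (u : RatUnit) (κ : RatUnit → UnitI) (w : ℕ → UnitI) (j : ℕ) :
    Prec ((chainFml u j).eval standardGodel κ w) ((chainFml u (j + 1)).eval standardGodel κ w) := by
  change Prec _ (max (standardGodel.imp (w j) ((chainFml u j).eval standardGodel κ w)) (w j))
  rcases le_or_gt (w j) ((chainFml u j).eval standardGodel κ w) with h | h
  · rw [standardGodel_imp_of_le h, max_eq_left unitInterval.le_one']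
    exact prec_one _
  · rw [standardGodel_imp_of_lt h, max_eq_right h.le]
    exact Or.inl h

theorem prec_chainFml (u : RatUnit) (κ : RatUnit → UnitI) (w : ℕ → UnitI) {i j : ℕ} (h : i < j) :
    Prec ((chainFml u i).eval standardGodel κ w) ((chainFml u j).eval standardGodel κ w) := by
  induction j, h using Nat.le_induction with
  | base => exact prec_chainFml_succ u κ w i
  | succ j _ ih => exact ih.trans (prec_chainFml_succ u κ w j)

/-- If each variable lies above the preceding formula of the sequence, then the implication in the
next formula has the smaller value, and the join equals the variable. -/
theorem eval_chainFml_of_strictMono (u : RatUnit) (κ : RatUnit → UnitI) (w : ℕ → UnitI) {m : ℕ}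
    {e : Fin m → UnitI} (he : StrictMono e) (hu : ∀ i, κ u < e i) (hw : ∀ i : Fin m, w i = e i)
    (i : Fin m) : (chainFml u (i + 1)).eval standardGodel κ w = e i := by
  obtain ⟨i, hi⟩ := i
  have key : (chainFml u i).eval standardGodel κ w < e ⟨i, hi⟩ →
      (chainFml u (i + 1)).eval standardGodel κ w = e ⟨i, hi⟩ := fun h => by
    have hwi : w i = e ⟨i, hi⟩ := hw ⟨i, hi⟩
    change max (standardGodel.imp (w i) ((chainFml u i).eval standardGodel κ w)) (w i) = _
    rw [hwi, standardGodel_imp_of_lt h, max_eq_right h.le]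
  induction i with
  | zero => exact key (hu _)
  | succ i ih =>
    refine key ?_
    rw [ih (by omega) fun h => ?_]
    · exact he (Fin.mk_lt_mk.2 (Nat.lt_succ_self i))
    · have hwi : w i = e ⟨i, by omega⟩ := hw ⟨i, by omega⟩
      change max (standardGodel.imp (w i) ((chainFml u i).eval standardGodel κ w)) (w i) = _
      rw [hwi, standardGodel_imp_of_lt h, max_eq_right h.le]

/-- The correspondence between a chain consisting of constants up to `u`, finitely many elements
`e i` above `u`, and `1`, and the values of constants and of `chainFml`. -/
theorem chainRel_chainFml {S : Finset RatUnit} {u : RatUnit} (h0 : 0 ∈ S) (hu : u ∈ S)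
    {κ : RatUnit → UnitI} (hκ : RespectsOn S κ) (w : ℕ → UnitI) {m : ℕ}
    {e : Fin m → UnitI} (he : StrictMono e) (hue : ∀ i, ratPoint u < e i) :
    ChainRel fun a a' => (∃ s ∈ S, s ≤ u ∧ a = ratPoint s ∧ a' = κ s) ∨ (a = 1 ∧ a' = 1) ∨
      ∃ i : Fin m, a = e i ∧ a' = (chainFml u (i + 1)).eval standardGodel κ w where
  zero := Or.inl ⟨0, h0, u.2.1, ratPoint_zero.symm, hκ.zero.symm⟩
  one := Or.inr (Or.inl ⟨rfl, rfl⟩)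
  prec := by
    rintro a a' b b' (⟨s, hs, hsu, rfl, rfl⟩ | ⟨rfl, rfl⟩ | ⟨i, rfl, rfl⟩)
      (⟨t, ht, htu, rfl, rfl⟩ | ⟨rfl, rfl⟩ | ⟨j, rfl, rfl⟩) h
    · exact hκ.prec s hs t ht (ratPoint_lt.1 h)
    · exact prec_one _
    · have h1 : Prec (κ u) ((chainFml u (j + 1)).eval standardGodel κ w) :=
        prec_chainFml u κ w (Nat.succ_pos j)
      rcases eq_or_lt_of_le hsu with rfl | hlt
      · exact h1
      · exact (hκ.prec s hs u hu hlt).trans h1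
    · exact absurd h (not_lt.2 unitInterval.le_one')
    · exact prec_one _
    · exact absurd h (not_lt.2 unitInterval.le_one')
    · exact absurd (h.trans_le (ratPoint_le.2 htu)) (not_lt.2 (hue i).le)
    · exact prec_one _
    · exact prec_chainFml u κ w (Nat.succ_lt_succ (he.lt_iff_lt.1 h))
  unique := by
    rintro a a' b' ha (⟨s, hs, hsu, rfl, rfl⟩ | ⟨h, -⟩ | ⟨i, rfl, rfl⟩)
      (⟨t, ht, htu, h', rfl⟩ | ⟨h', -⟩ | ⟨j, h', rfl⟩)
    · rcases lt_trichotomy s t with h | rfl | h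
      · exact absurd h' (ratPoint_lt.2 h).ne
      · rfl
      · exact absurd h' (ratPoint_lt.2 h).ne'
    · exact absurd h' ha
    · exact absurd (h' ▸ hue j) (not_lt.2 (ratPoint_le.2 hsu))
    · exact absurd h ha
    · exact absurd h ha
    · exact absurd h ha
    · exact absurd (h' ▸ hue i) (not_lt.2 (ratPoint_le.2 htu))
    · exact absurd h' ha
    · rw [he.injective h']

-- A rule not derivable with `constRules Q` fails in the reference model at a rational assignment;
-- `σ` describes this assignment by formulas and so witnesses that the rule is not admissible.
open Classical in
theorem CollapseData.structurallyComplete (hD : CollapseData D Q p γ) :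
    StructurallyComplete (AddRules (collapseLogic D p γ) (constRules Q)) := by
  rintro ⟨Γ, φ⟩ hadm
  by_contra hder
  change ¬ AddRules (collapseLogic D p γ) (constRules Q) ↑Γ φ at hder
  have hL : ∀ q ∈ Q, ¬ collapseLogic D p γ ↑Γ (.join (.const q) φ) := fun q hq h => by
    refine hder (AddRules.rule (constRule q) (R := constRules Q) ⟨q, hq, rfl⟩ (fun _ => φ) fun χ hχ => ?_)
    rw [Finset.mem_singleton.1 hχ]
    exact .base _ _ (fun δ hδ => .hyp δ hδ) h
  set S₀ : Finset RatUnit := Γ.biUnion Fml.consts ∪ φ.consts ∪ {0, 1, p} with hS₀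
  set V : Finset ℕ := Γ.biUnion Fml.vars ∪ φ.vars with hV
  obtain ⟨u, huQ, hu⟩ : ∃ u ∈ Q, ∀ s ∈ S₀, s ∈ D → s ≤ u := by
    have hne : (S₀.filter (· ∈ D)).Nonempty := ⟨0, by simp [hS₀, hD.zero_mem]⟩
    obtain ⟨u, hu, hle⟩ := hD.cofinal _ (Finset.mem_filter.1 (Finset.max'_mem _ hne)).2
    exact ⟨u, hu, fun s hs hsD =>
      (Finset.le_max' _ s (Finset.mem_filter.2 ⟨hs, hsD⟩)).trans hle⟩
  have huD := hD.subset huQ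
  set S := insert u S₀ with hS
  have h0S : 0 ∈ S := by simp [hS, hS₀]
  have h1S : 1 ∈ S := by simp [hS, hS₀]
  have huS : u ∈ S := by simp [hS]
  have hSu : ∀ s ∈ S, s ∈ D → s ≤ u := fun s hs hsD => by
    rcases Finset.mem_insert.1 hs with rfl | hs
    · exact le_rfl
    · exact hu s hs hsD
  have hφS : φ.consts ⊆ S := fun c hc => by simp [hS, hS₀, hc]
  have hΓS : ∀ ψ ∈ Γ, ψ.consts ⊆ S := fun ψ hψ c hc =>
    Finset.mem_insert_of_mem (Finset.mem_union_left _ (Finset.mem_union_left _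
      (Finset.mem_biUnion.2 ⟨ψ, hψ, hc⟩)))
  have hφV : φ.vars ⊆ V := Finset.subset_union_right
  have hΓV : ∀ ψ ∈ Γ, ψ.vars ⊆ V := fun ψ hψ c hc =>
    Finset.mem_union_left _ (Finset.mem_biUnion.2 ⟨ψ, hψ, hc⟩)
  obtain ⟨v, hvq, hvV, hfew, hvΓ, hvφ⟩ : ∃ v : ℕ → UnitI, (∀ i, ∃ q, v i = ratPoint q) ∧
      (∀ i ∉ V, v i = 1) ∧ FewAbove p γ v ∧
      (∀ ψ ∈ Γ, ψ.eval standardGodel (constIn D) v = 1) ∧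
      φ.eval standardGodel (constIn D) v ≠ 1 := by
    -- Refuting `c_u ∨ φ` instead of `φ` keeps `κ u` below 1, and with it the value of every
    -- constant in `S ∩ D`; this is what the transfer of truth requires.
    obtain ⟨κ, v, v', hκ, hΓ, hφ, hq, hv'V, hfew, h⟩ := exists_rational_model (hL u huQ) S V h0S h1S
      (by simp [hS, hS₀])
    change max (κ u) (φ.eval standardGodel κ v) ≠ 1 at hφ
    have hmax : ∀ x ≤ max (κ u) (φ.eval standardGodel κ v), x ≠ 1 := fun x hx h1 =>
      hφ (le_antisymm unitInterval.le_one' (h1 ▸ hx))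
    refine ⟨v', hq, hv'V, hfew, fun ψ hψ => (h ψ (hΓS ψ hψ) (hΓV ψ hψ)).2 (fun s hs hsD => ?_)
      (hΓ ψ hψ), (h φ hφS hφV).1 (hmax _ (le_max_right _ _))⟩
    refine hmax _ (le_trans ?_ (le_max_left _ _))
    rcases eq_or_lt_of_le (hSu s hs hsD) with rfl | hlt
    · exact le_rfl
    · exact (hκ.prec s hs u huS hlt).le
  choose q hq using hvq
  set high : Finset UnitI := (V.image v).filter fun a => ratPoint u < a ∧ a < 1 with hhigh
  set e := high.orderEmbOfFin rfl with he
  have hemem : ∀ i, e i ∈ high := fun i => Finset.orderEmbOfFin_mem _ rfl i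
  have hue : ∀ i, ratPoint u < e i := fun i => (Finset.mem_filter.1 (hemem i)).2.1
  have he1 : ∀ i, e i < 1 := fun i => (Finset.mem_filter.1 (hemem i)).2.2
  have hv3 : ∀ i, v i ≤ ratPoint u ∨ v i = 1 ∨ ∃ j, v i = e j := fun i => by
    rcases le_or_gt (v i) (ratPoint u) with h | h
    · exact Or.inl h
    rcases eq_or_lt_of_le (unitInterval.le_one' (t := v i)) with h1 | h1
    · exact Or.inr (Or.inl h1)
    · have hi : i ∈ V := by
        by_contra hi
        exact absurd (hvV i hi) h1.ne
      have hm : v i ∈ Set.range e := by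
        rw [he, Finset.range_orderEmbOfFin]
        exact Finset.mem_filter.2 ⟨Finset.mem_image_of_mem _ hi, h, h1⟩
      obtain ⟨j, hj⟩ := hm
      exact Or.inr (Or.inr ⟨j, hj.symm⟩)
  -- Values up to `u` are named by constants, and the `j`-th value strictly between `u` and 1 by
  -- `chainFml u (j + 1)`; the shift is there because `chainFml u 0` is `c_u` itself.
  let σ : ℕ → RFml := fun i => if v i ≤ ratPoint u then .const (q i) else
    if h : ∃ j, v i = e j then chainFml u (h.choose + 1) else .one
  set S' := S ∪ V.image q with hS'
  have huS' : u ∈ S' := Finset.mem_union_left _ huS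
  have h0S' : 0 ∈ S' := Finset.mem_union_left _ h0S
  have hrel : ∀ (κ : RatUnit → UnitI) (w : ℕ → UnitI), RespectsOn S' κ →
      (∀ s ∈ S', s ∉ D → κ s = 1) → ∀ ψ : RFml, ψ.consts ⊆ S → ψ.vars ⊆ V →
      (∃ s ∈ S', s ≤ u ∧ ψ.eval standardGodel (constIn D) v = ratPoint s ∧
        (ψ.subst σ).eval standardGodel κ w = κ s) ∨
      (ψ.eval standardGodel (constIn D) v = 1 ∧ (ψ.subst σ).eval standardGodel κ w = 1) ∨
      ∃ i, ψ.eval standardGodel (constIn D) v = e i ∧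
        (ψ.subst σ).eval standardGodel κ w =
          (chainFml u (i + 1)).eval standardGodel κ w := by
    intro κ w hκ hκD ψ hψS hψV
    rw [Fml.eval_subst]
    refine (chainRel_chainFml h0S' huS' hκ w e.strictMono hue).eval ψ
      (fun c hc => ?_) fun i hi => ?_
    · have hcS := hψS hc
      have hcS' : c ∈ S' := Finset.mem_union_left _ hcS
      by_cases hcD : c ∈ D
      · exact Or.inl ⟨c, hcS', hSu c hcS hcD, constIn_of_mem hcD, rfl⟩
      · exact Or.inr (Or.inl ⟨constIn_of_notMem hcD, hκD c hcS' hcD⟩)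
    · by_cases hle : v i ≤ ratPoint u
      · refine Or.inl ⟨q i, Finset.mem_union_right _ (Finset.mem_image_of_mem _ (hψV hi)), ?_,
          hq i, ?_⟩
        · rwa [hq i, ratPoint_le] at hle
        · simp only [σ, if_pos hle]
          rfl
      · by_cases hj : ∃ j, v i = e j
        · refine Or.inr (Or.inr ⟨hj.choose, hj.choose_spec, ?_⟩)
          simp only [σ, if_neg hle, dif_pos hj]
        · refine Or.inr (Or.inl ⟨?_, ?_⟩)
          · rcases hv3 i with h | h | h
            · exact absurd h hle
            · exact h
            · exact absurd h hj
          · simp only [σ, if_neg hle, dif_neg hj]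
            rfl
  have hthm : ∀ ψ ∈ Γ, collapseLogic D p γ ∅ (ψ.subst σ) := fun ψ hψ => by
    by_contra hno
    rw [← Finset.coe_empty] at hno
    obtain ⟨κ, w, hκ, hκD, -, -, hne⟩ := exists_refutation hno S' ∅
    -- The premise has value 1 in the reference model, and 1 is neither a constant up to `u` nor one
    -- of the `e i`, so its instance has value 1 under `κ, w` too.
    rcases hrel κ w hκ hκD ψ (hΓS ψ hψ) (hΓV ψ hψ) with ⟨s, -, hsu, h, -⟩ | ⟨-, h⟩ | ⟨i, h, -⟩
    · rw [hvΓ ψ hψ] at h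
      exact absurd h (((ratPoint_le.2 hsu).trans_lt (hD.lt_one huD)).ne')
    · exact hne h
    · rw [hvΓ ψ hψ] at h
      exact absurd h (he1 i).ne'
  have hφthm := hadm σ fun ψ hψ =>
    .base ∅ _ (fun _ h => absurd h (Set.notMem_empty _)) (hthm ψ hψ)
  -- This assignment makes the chain formulas take the values `e i`. All its values are 1 or values
  -- of `v`, so the bound above `p` persists.
  set w : ℕ → UnitI := fun j => if h : j < high.card then e ⟨j, h⟩ else 1 with hw
  have hwe : ∀ i : Fin high.card, w i = e i := fun i => dif_pos i.2
  have hwfew : FewAbove p γ w := fun n hn => by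
    obtain ⟨H, hcard, hpH, h1H, hH⟩ := hfew n hn
    refine ⟨H, hcard, hpH, h1H, fun j => ?_⟩
    by_cases hj : j < high.card
    · rw [show w j = e ⟨j, hj⟩ from dif_pos hj]
      obtain ⟨i, -, hi⟩ := Finset.mem_image.1 (Finset.mem_filter.1 (hemem ⟨j, hj⟩)).1
      rw [← hi]
      exact hH i
    · rwa [show w j = 1 from dif_neg hj, max_eq_right unitInterval.le_one']
  have hval := hD.sound_addRules hwfew hφthm (by simp)
  dsimp only at hval
  have hs := hD.respectsOn_constIn S'
  rcases hrel _ w hs (fun s _ h => constIn_of_notMem h) φ hφS hφV with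
    ⟨s, -, hsu, -, h⟩ | ⟨h, -⟩ | ⟨i, -, h⟩
  · have hsD := hD.lower s u hsu huD
    rw [hval, constIn_of_mem hsD] at h
    exact (hD.lt_one hsD).ne' h
  · exact hvφ h
  · rw [hval, eval_chainFml_of_strictMono u _ w e.strictMono
      (fun i => by rw [constIn_of_mem huD]; exact hue i) hwe i] at h
    exact (he1 i).ne' h

theorem CollapseData.isBaseOfAdmissibleRules (hD : CollapseData D Q p γ) :
    IsBaseOfAdmissibleRules (collapseLogic D p γ) (constRules Q) where
  isLogic := (RG_isLogic.axExt _).addRules _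
  extension Γ φ h := .base Γ φ (fun δ hδ => .hyp δ hδ) h
  structurallyComplete := hD.structurallyComplete
  theorems φ := ⟨hD.theorem_of_addRules, fun h => .base ∅ φ (fun δ hδ => .hyp δ hδ) h⟩

end

theorem theorem8p4 :
    (∀ r : ℝ, 0 < r → r ≤ 1 →
      IsBaseOfAdmissibleRules (RGr r)
        {ρ | ∃ q : RatUnit, ((q : ℚ) : ℝ) < r ∧ ρ = constRule q}) ∧
    (∀ (p : RatUnit) (γ : ℕ∞), p < 1 →
      IsBaseOfAdmissibleRules (RGpγ p γ) {constRule p}) := by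
  constructor
  · intro r hr0 hr1
    have hD : CollapseData {q : RatUnit | ((q : ℚ) : ℝ) < r} {q | ((q : ℚ) : ℝ) < r} 0 ⊤ :=
      { lower := fun s t hst ht => (Rat.cast_le.2 (Subtype.coe_le_coe.2 hst)).trans_lt
          (Set.mem_ofPred.1 ht)
        zero_mem := by simpa using hr0
        one_notMem := by simpa using hr1
        subset := subset_rfl
        cofinal := fun s hs => ⟨s, hs, le_rfl⟩
        greatest := fun n hn => absurd hn (ENat.top_ne_natCast n) }
    have hL : RGr r = collapseLogic {q : RatUnit | ((q : ℚ) : ℝ) < r} 0 ⊤ := by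
      unfold RGr collapseLogic collapseAxioms
      congr 1
      ext φ
      simp
    rw [hL]
    exact hD.isBaseOfAdmissibleRules
  · intro p γ hp
    have hD : CollapseData (Set.Iic p) {p} p γ :=
      { lower := fun s t hst ht => hst.trans ht
        zero_mem := p.2.1
        one_notMem := not_le.2 hp
        subset := by simp
        cofinal := fun s hs => ⟨p, rfl, hs⟩
        greatest := fun n _ => ⟨Set.mem_Iic.2 le_rfl, fun q hq => hq⟩ }
    have hL : RGpγ p γ = collapseLogic (Set.Iic p) p γ := by
      unfold RGpγ collapseLogic collapseAxioms
      simp only [Set.mem_Iic, not_le]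
    have hR : ({constRule p} : Set (PropRule RatUnit)) = constRules {p} := by
      ext ρ
      simp [constRules]
    rw [hL, hR]
    exact hD.isBaseOfAdmissibleRules
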